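/- A \emph{continuum} is a nonempty compact connected metrizable space. An \emph{arc} in a space $X$ is a map $\alpha:[0,1]\to X$ that is a homeomorphism onto its image (or that image); its end points are $\alpha(0)$ and $\alpha(1)$. A \emph{finite graph} is a continuum that is the union of finitely many arcs, any two of which are either disjoint or meet only in common end points. A point $p\in X$ is a \emph{cut point} if $X\setminus\{p\}$ is not connected. The space $X$ is \emph{$3$-strongly arc connected} ($3$-sac) if for all distinct $x_1,x_2,x_3\in X$ there are an arc $\alpha:[0,1]\to X$ and $t_1<t_2<t_3$ in $[0,1]$ with $\alpha(t_i)=x_i$ for $i=1,2,3$. A \emph{circle} in $X$ is a subspace of $X$ homeomorphic to the unit circle $S^1$, and a \emph{theta curve} in $X$ is a union of three arcs in $X$ that have the same two end points $a,b$ and pairwise meet exactly in $\{a,b\}$. Let $X$ be a finite graph. Then the following are equivalent: (1) $X$ has no cut points; (2) $X$ is $3$-sac; (3) for any three points $x,y,z\in X$ (not necessarily distinct) there is a circle or a theta curve in $X$ that contains $x$, $y$ and $z$. -/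

import Mathlib

open Topology

/-- A continuum: a nonempty compact connected metrizable space
(`ConnectedSpace` includes non-emptiness). -/
structure IsContinuum (X : Type*) [TopologicalSpace X] : Prop where
  compact : CompactSpace X
  connected : ConnectedSpace X
  metrizable : TopologicalSpace.MetrizableSpace X

/-- An arc `α : [0,1] → X`, that is, a homeomorphism of `[0,1]` onto its image. Its end points are
`α 0` and `α 1`. -/
def IsArc {X : Type*} [TopologicalSpace X] (α : unitInterval → X) : Prop :=
  IsEmbedding α

/-- A finite (topological) graph: a continuum which is the union of finitely many arcs, any two of
which are disjoint or meet only in common end points. -/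
def IsFiniteGraph (X : Type*) [TopologicalSpace X] : Prop :=
  IsContinuum X ∧
    ∃ (m : ℕ) (e : Fin m → unitInterval → X),
      (∀ i, IsArc (e i)) ∧
      (⋃ i, Set.range (e i)) = Set.univ ∧
      ∀ i j, i ≠ j →
        Set.range (e i) ∩ Set.range (e j) ⊆ {e i 0, e i 1} ∩ {e j 0, e j 1}

/-- `p` is a cut point of `X` if `X \ {p}` is not connected. -/
def IsCutPoint {X : Type*} [TopologicalSpace X] (p : X) : Prop :=
  ¬ IsConnected ({p}ᶜ : Set X)

/-- `X` is `n`-strongly arc connected: any `n` distinct points are visited in the given order by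
some arc. -/
def IsSac (n : ℕ) (X : Type*) [TopologicalSpace X] : Prop :=
  ∀ x : Fin n → X, Function.Injective x →
    ∃ α : unitInterval → X, IsArc α ∧
      ∃ t : Fin n → unitInterval, StrictMono t ∧ ∀ i, α (t i) = x i

/-- A circle in `X`: a subspace homeomorphic to the unit circle. -/
def IsCircle {X : Type*} [TopologicalSpace X] (C : Set X) : Prop :=
  Nonempty (C ≃ₜ Circle)

/-- A theta curve in `X`: the union of three arcs with the same two end points `a`, `b`, any two of
which meet exactly in `{a, b}`. -/
def IsThetaCurve {X : Type*} [TopologicalSpace X] (T : Set X) : Prop :=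
  ∃ (a b : X) (α : Fin 3 → unitInterval → X),
    (∀ i, IsArc (α i) ∧ α i 0 = a ∧ α i 1 = b) ∧
    (∀ i j, i ≠ j → Set.range (α i) ∩ Set.range (α j) = {a, b}) ∧
    T = ⋃ i, Set.range (α i)

/-! ### Arcs parametrized by real intervals: splitting, trimming, gluing -/

section
open Set

variable {X : Type*} [TopologicalSpace X]

/-! The core is (1) → (3). Fix a circle `C` and let `earHull C` be `C` together with all its ears,
the arcs meeting `C` exactly in their two end points. Without cut points the hull is all of `X`
(`earHull_eq_univ`). Indeed, a circle meeting the interior of an edge contains that edge, and every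
ear lies on a circle inside the hull, so an edge whose interior meets the hull lies in it. By
connectedness, an edge outside the hull could be chosen with an end point `p` in it. As `p` is not a
cut point, some arc leads back from the edge to the hull without passing `p`; trimmed, it yields an
ear containing interior points of that edge (`exists_mem_earHull`), a contradiction.

Rerouting a circle through an ear keeps any one prescribed point, so two points always share a
circle `C`. A third point lies on `C` or on an ear of `C`, and `C` with an ear is a theta curve.

For (3) → (2), three points of a circle or theta curve are traced in order explicitly. For (2) →
(1), an arc through `x`, `y`, `p` in this order joins `x` to `y` before reaching `p`. -/

/-- `A` is an arc with end points `a` and `b`. -/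
def IsArcBetween (A : Set X) (a b : X) : Prop :=
  ∃ f : ℝ → X, ContinuousOn f (Icc 0 1) ∧ InjOn f (Icc 0 1) ∧ f 0 = a ∧ f 1 = b ∧
    f '' Icc 0 1 = A

namespace IsArcBetween

variable {A B : Set X} {a b c : X}

lemma image_Icc {f : ℝ → X} {s t : ℝ} (hst : s < t) (hc : ContinuousOn f (Icc s t))
    (hi : InjOn f (Icc s t)) : IsArcBetween (f '' Icc s t) (f s) (f t) := by
  have him : (fun x : ℝ => (t - s) * x + s) '' Icc 0 1 = Icc s t := by
    rw [image_affine_Icc' (sub_pos.2 hst)]; simp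
  refine ⟨fun x => f ((t - s) * x + s), ?_, ?_, by simp, by simp, ?_⟩
  · exact hc.comp (by fun_prop) fun x hx => him ▸ mem_image_of_mem _ hx
  · intro x hx y hy hxy
    have := hi (him ▸ mem_image_of_mem _ hx) (him ▸ mem_image_of_mem _ hy) hxy
    have h0 : t - s ≠ 0 := (sub_pos.2 hst).ne'
    exact mul_left_cancel₀ h0 (by simpa using this)
  · rw [← him, image_image]

lemma image_neg_Icc {f : ℝ → X} {s t : ℝ} (hst : s < t) (hc : ContinuousOn f (Icc s t))
    (hi : InjOn f (Icc s t)) : IsArcBetween (f '' Icc s t) (f t) (f s) := by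
  have him : Neg.neg '' Icc (-t) (-s) = Icc s t := by simp
  have := image_Icc (f := fun x => f (-x)) (neg_lt_neg hst)
    (hc.comp (by fun_prop) fun x hx => him ▸ mem_image_of_mem _ hx)
    (fun x hx y hy hxy => neg_injective
      (hi (him ▸ mem_image_of_mem _ hx) (him ▸ mem_image_of_mem _ hy) hxy))
  rw [← him, image_image]
  simpa using this

lemma symm (h : IsArcBetween A a b) : IsArcBetween A b a := by
  obtain ⟨f, hc, hi, rfl, rfl, rfl⟩ := h
  exact image_neg_Icc one_pos hc hi

lemma left_mem (h : IsArcBetween A a b) : a ∈ A := by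
  obtain ⟨f, hc, hi, rfl, rfl, rfl⟩ := h
  exact mem_image_of_mem _ (by simp)

lemma right_mem (h : IsArcBetween A a b) : b ∈ A := h.symm.left_mem

lemma ne (h : IsArcBetween A a b) : a ≠ b := by
  obtain ⟨f, hc, hi, rfl, rfl, rfl⟩ := h
  intro h
  exact zero_ne_one (hi (by simp) (by simp) h)

lemma isCompact (h : IsArcBetween A a b) : IsCompact A := by
  obtain ⟨f, hc, hi, rfl, rfl, rfl⟩ := h
  exact isCompact_Icc.image_of_continuousOn hc

lemma isClosed [T2Space X] (h : IsArcBetween A a b) : IsClosed A := h.isCompact.isClosed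

lemma isPreconnected (h : IsArcBetween A a b) : IsPreconnected A := by
  obtain ⟨f, hc, hi, rfl, rfl, rfl⟩ := h
  exact isPreconnected_Icc.image _ hc

lemma split (h : IsArcBetween A a b) (hc : c ∈ A) (hca : c ≠ a) (hcb : c ≠ b) :
    ∃ A₁ A₂, IsArcBetween A₁ a c ∧ IsArcBetween A₂ c b ∧ A₁ ∪ A₂ = A ∧ A₁ ∩ A₂ = {c} := by
  obtain ⟨f, hf, hi, rfl, rfl, rfl⟩ := h
  obtain ⟨t, ht, rfl⟩ := hc
  have h0 : 0 < t := ht.1.lt_of_ne (by rintro rfl; exact hca rfl)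
  have h1 : t < 1 := ht.2.lt_of_ne (by rintro rfl; exact hcb rfl)
  have s1 : Icc 0 t ⊆ Icc (0 : ℝ) 1 := Icc_subset_Icc_right h1.le
  have s2 : Icc t 1 ⊆ Icc (0 : ℝ) 1 := Icc_subset_Icc_left h0.le
  refine ⟨f '' Icc 0 t, f '' Icc t 1, image_Icc h0 (hf.mono s1) (hi.mono s1),
    image_Icc h1 (hf.mono s2) (hi.mono s2), ?_, ?_⟩
  · rw [← image_union, Icc_union_Icc_eq_Icc h0.le h1.le]
  · rw [← hi.image_inter s1 s2, Icc_inter_Icc_eq_singleton h0.le h1.le, image_singleton]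

lemma exists_subarc_right (h : IsArcBetween A a b) (hc : c ∈ A) (hcb : c ≠ b) :
    ∃ B ⊆ A, IsArcBetween B c b := by
  by_cases hca : c = a
  · exact ⟨A, subset_rfl, hca ▸ h⟩
  · obtain ⟨A₁, A₂, -, h2, h3, -⟩ := h.split hc hca hcb
    exact ⟨A₂, h3 ▸ subset_union_right, h2⟩

/-- The part of an arc up to its first point in a closed set. -/
lemma exists_first_hit [T2Space X] (h : IsArcBetween A a b) {F : Set X} (hF : IsClosed F)
    (hb : b ∈ F) (ha : a ∉ F) : ∃ B ⊆ A, ∃ c ∈ F, IsArcBetween B a c ∧ B ∩ F = {c} := by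
  obtain ⟨f, hf, hi, rfl, rfl, rfl⟩ := h
  have hcl : IsCompact (Icc (0 : ℝ) 1 ∩ f ⁻¹' F) :=
    isCompact_Icc.of_isClosed_subset (hf.preimage_isClosed_of_isClosed isClosed_Icc hF)
      inter_subset_left
  obtain ⟨t, ⟨ht, htF⟩, hmin⟩ := hcl.exists_isLeast ⟨1, by simp, hb⟩
  have h0 : 0 < t := ht.1.lt_of_ne (by rintro rfl; exact ha htF)
  have s1 : Icc 0 t ⊆ Icc (0 : ℝ) 1 := Icc_subset_Icc_right ht.2
  refine ⟨f '' Icc 0 t, image_mono s1, f t, htF, image_Icc h0 (hf.mono s1) (hi.mono s1), ?_⟩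
  ext x
  constructor
  · rintro ⟨⟨s, hs, rfl⟩, hx⟩
    rw [le_antisymm hs.2 (hmin ⟨s1 hs, hx⟩)]
    rfl
  · rintro rfl
    exact ⟨mem_image_of_mem _ ⟨h0.le, le_rfl⟩, htF⟩

/-- The parameter interval has length 2 so that the junction keeps the known parameter 1;
`ArcThrough.exists_isArc` needs it for its middle point. -/
lemma exists_param_union (hA : IsArcBetween A a b) (hB : IsArcBetween B b c) (h : A ∩ B ⊆ {b}) :
    ∃ f : ℝ → X, ContinuousOn f (Icc 0 2) ∧ InjOn f (Icc 0 2) ∧ f 0 = a ∧ f 1 = b ∧ f 2 = c ∧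
      f '' Icc 0 2 = A ∪ B := by
  obtain ⟨f, hf, hi, rfl, hfb, rfl⟩ := hA
  obtain ⟨g, hg, hj, rfl, rfl, rfl⟩ := hB
  set k : ℝ → X := fun x => if x ≤ 1 then f x else g (x - 1) with hk
  have k1 : ∀ x ≤ 1, k x = f x := fun x hx => if_pos hx
  have k2 : ∀ x, 1 ≤ x → k x = g (x - 1) := by
    intro x hx
    rcases hx.eq_or_lt with rfl | hx
    · simp [hk, hfb]
    · exact if_neg hx.not_ge
  have hU : Icc (0 : ℝ) 2 = Icc 0 1 ∪ Icc 1 2 :=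
    (Icc_union_Icc_eq_Icc (by norm_num) (by norm_num)).symm
  have c1 : ContinuousOn k (Icc 0 1) := hf.congr fun x hx => k1 x hx.2
  have c2 : ContinuousOn k (Icc 1 2) :=
    ContinuousOn.congr (f := fun x => g (x - 1))
      (hg.comp (by fun_prop) fun x hx => ⟨by linarith [hx.1], by linarith [hx.2]⟩)
      fun x hx => k2 x hx.1
  have key : ∀ x ∈ Icc (0 : ℝ) 1, ∀ y ∈ Icc (1 : ℝ) 2, k x = k y → x = y := by
    intro x hx y hy hxy
    rw [k1 x hx.2, k2 y hy.1] at hxy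
    have hy' : y - 1 ∈ Icc (0 : ℝ) 1 := ⟨by linarith [hy.1], by linarith [hy.2]⟩
    have hm : f x = g 0 := h ⟨mem_image_of_mem _ hx, hxy ▸ mem_image_of_mem _ hy'⟩
    have e1 := hi hx (by simp) (hm.trans hfb.symm)
    have e2 := hj hy' (by simp) (hxy.symm.trans hm)
    linarith
  refine ⟨k, hU ▸ c1.union_of_isClosed c2 isClosed_Icc isClosed_Icc, ?_, k1 0 (by norm_num),
    (k1 1 le_rfl).trans hfb, ?_, ?_⟩
  · rw [hU]
    rintro x (hx | hx) y (hy | hy) hxy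
    · rw [k1 x hx.2, k1 y hy.2] at hxy
      exact hi hx hy hxy
    · exact key x hx y hy hxy
    · exact (key y hy x hx hxy.symm).symm
    · rw [k2 x hx.1, k2 y hy.1] at hxy
      have := hj ⟨by linarith [hx.1], by linarith [hx.2]⟩ ⟨by linarith [hy.1], by linarith [hy.2]⟩ hxy
      linarith
  · rw [k2 2 (by norm_num)]; norm_num
  · rw [hU, image_union, image_congr fun x hx => k1 x hx.2]
    have him : (fun x : ℝ => x - 1) '' Icc 1 2 = Icc 0 1 := by
      rw [image_sub_const_Icc]; norm_num
    have him' : g '' Icc 0 1 = (fun x => g (x - 1)) '' Icc 1 2 := by rw [← him, image_image]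
    rw [image_congr (s := Icc (1 : ℝ) 2) fun x hx => k2 x hx.1, him']

lemma union (hA : IsArcBetween A a b) (hB : IsArcBetween B b c) (h : A ∩ B ⊆ {b}) :
    IsArcBetween (A ∪ B) a c := by
  obtain ⟨f, hc, hi, rfl, rfl, rfl, hf⟩ := hA.exists_param_union hB h
  exact hf ▸ image_Icc two_pos hc hi

end IsArcBetween
end

/-! ### Embedded arcs and circles -/

section
open Set

variable {X : Type*} [TopologicalSpace X] {A B C : Set X} {a b c x y z : X}

lemma IsArc.isArcBetween_image {α : unitInterval → X} (h : IsArc α) {s t : unitInterval}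
    (hst : s < t) : IsArcBetween (α '' Icc s t) (α s) (α t) := by
  have hp : ∀ u : unitInterval, projIcc 0 1 zero_le_one (u : ℝ) = u := projIcc_val _
  have hsub : Icc (s : ℝ) t ⊆ Icc 0 1 := Icc_subset_Icc s.2.1 t.2.2
  have := IsArcBetween.image_Icc (f := fun x => α (projIcc 0 1 zero_le_one x)) (s := s) (t := t) hst
    (h.continuous.comp continuous_projIcc).continuousOn
    (h.injective.comp_injOn (by
      intro x hx y hy hxy
      have := congrArg Subtype.val hxy
      rwa [projIcc_of_mem _ (hsub hx), projIcc_of_mem _ (hsub hy)] at this))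
  rw [hp, hp] at this
  convert this using 1
  ext x
  constructor
  · rintro ⟨u, hu, rfl⟩
    exact ⟨u, hu, by simp⟩
  · rintro ⟨u, hu, rfl⟩
    exact ⟨⟨u, hsub hu⟩, hu, by simp [projIcc_of_mem _ (hsub hu)]⟩

lemma IsArc.isArcBetween_range {α : unitInterval → X} (h : IsArc α) :
    IsArcBetween (range α) (α 0) (α 1) := by
  have := h.isArcBetween_image zero_lt_one
  rwa [show Icc (0 : unitInterval) 1 = univ from Icc_bot_top, image_univ] at this

lemma exists_isArc_of_injOn [T2Space X] {f : ℝ → X} (hf : ContinuousOn f (Icc 0 1))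
    (hi : InjOn f (Icc 0 1)) : IsArc (fun u : unitInterval => f u) :=
  (Continuous.isClosedEmbedding (continuousOn_iff_continuous_domRestrict.1 hf)
    (injOn_iff_injective.1 hi)).isEmbedding

lemma IsArcBetween.exists_isArc [T2Space X] (h : IsArcBetween A a b) :
    ∃ α : unitInterval → X, IsArc α ∧ α 0 = a ∧ α 1 = b ∧ range α = A := by
  obtain ⟨f, hf, hi, rfl, rfl, rfl⟩ := h
  refine ⟨_, exists_isArc_of_injOn hf hi, by simp, by simp, ?_⟩
  rw [image_eq_range]

lemma IsCircle.exists_param (h : IsCircle C) (ha : a ∈ C) :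
    ∃ f : ℝ → X, Continuous f ∧ InjOn f (Ico 0 1) ∧ f 0 = a ∧ f 1 = a ∧ f '' Ico 0 1 = C := by
  obtain ⟨h⟩ := h
  let e : C ≃ₜ AddCircle (1 : ℝ) := h.trans (AddCircle.homeomorphCircle one_ne_zero).symm
  have hcov : ((↑) : ℝ → AddCircle (1 : ℝ)) '' Ico 0 1 = univ := by
    simpa using AddCircle.coe_image_Ico_eq (1 : ℝ) 0
  have h1 : ((1 : ℝ) : AddCircle (1 : ℝ)) = 0 := AddCircle.coe_period 1
  -- Translating by `e a` makes the parametrization start at the prescribed point.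
  refine ⟨fun t => e.symm (t + e ⟨a, ha⟩), ?_, ?_, by simp, by simp [h1], ?_⟩
  · exact continuous_subtype_val.comp (e.symm.continuous.comp
      ((AddCircle.continuous_mk' 1).add continuous_const))
  · intro s hs t ht hst
    have := e.symm.injective (Subtype.val_injective hst)
    have := add_right_cancel this
    exact (AddCircle.coe_eq_coe_iff_of_mem_Ico (p := (1 : ℝ)) (a := 0) (by simpa using hs)
      (by simpa using ht)).1 this
  · ext x
    constructor
    · rintro ⟨t, -, rfl⟩
      exact Subtype.coe_prop _
    · intro hx
      obtain ⟨t, ht, hte⟩ := hcov.symm ▸ mem_univ (e ⟨x, hx⟩ - e ⟨a, ha⟩)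
      exact ⟨t, ht, by simp [hte]⟩

lemma IsCircle.exists_arcs (h : IsCircle C) (ha : a ∈ C) (hb : b ∈ C) (hab : a ≠ b) :
    ∃ P Q, IsArcBetween P a b ∧ IsArcBetween Q a b ∧ P ∩ Q = {a, b} ∧ P ∪ Q = C := by
  obtain ⟨f, hf, hi, rfl, h1, rfl⟩ := h.exists_param ha
  obtain ⟨t, ht, rfl⟩ := hb
  have h0 : 0 < t := ht.1.lt_of_ne (by rintro rfl; exact hab rfl)
  -- Injectivity is known only on `[0, 1)`; the end 1 may be added because `f 1 = f 0` and 0 is not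
  -- in `[t, 1]`.
  have hi2 : InjOn f (Icc t 1) := by
    have aux : ∀ s ∈ Ico t 1, f s ≠ f 1 := by
      intro s hs he
      have := hi ⟨h0.le.trans hs.1, hs.2⟩ (by simp) (he.trans h1)
      linarith [hs.1]
    intro r hr s hs hrs
    rcases hr.2.eq_or_lt with rfl | hr'
    · rcases hs.2.eq_or_lt with rfl | hs'
      · rfl
      · exact (aux s ⟨hs.1, hs'⟩ hrs.symm).elim
    · rcases hs.2.eq_or_lt with rfl | hs'
      · exact (aux r ⟨hr.1, hr'⟩ hrs).elim
      · exact hi ⟨h0.le.trans hr.1, hr'⟩ ⟨h0.le.trans hs.1, hs'⟩ hrs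
  have hQ := IsArcBetween.image_neg_Icc ht.2 hf.continuousOn hi2
  rw [h1] at hQ
  refine ⟨f '' Icc 0 t, f '' Icc t 1, IsArcBetween.image_Icc h0 hf.continuousOn
    (hi.mono (Icc_subset_Ico_right ht.2)), hQ, ?_, ?_⟩
  · ext x
    constructor
    · rintro ⟨⟨s, hs, rfl⟩, r, hr, hrs⟩
      rcases hr.2.eq_or_lt with rfl | hr'
      · exact Or.inl (hrs.symm.trans h1)
      · have : r = s := hi ⟨h0.le.trans hr.1, hr'⟩ ⟨hs.1, hs.2.trans_lt ht.2⟩ hrs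
        subst this
        exact Or.inr (by rw [le_antisymm hr.1 hs.2]; rfl)
    · rintro (rfl | rfl)
      · exact ⟨⟨0, ⟨le_rfl, h0.le⟩, rfl⟩, 1, ⟨ht.2.le, le_rfl⟩, h1⟩
      · exact ⟨⟨t, ⟨h0.le, le_rfl⟩, rfl⟩, t, ⟨le_rfl, ht.2.le⟩, rfl⟩
  · rw [← image_union, Icc_union_Icc_eq_Icc h0.le ht.2.le, ← Ico_insert_right zero_le_one,
      image_insert_eq, h1]
    exact insert_eq_of_mem (mem_image_of_mem _ (by simp))

/-- Running along one arc and back along the other gives a loop on `[0, 2]`, injective except at its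
ends. It descends to a continuous injection of `AddCircle 2`, an embedding by compactness. -/
lemma IsArcBetween.isCircle_union [T2Space X] (hA : IsArcBetween A a b)
    (hB : IsArcBetween B a b) (h : A ∩ B = {a, b}) : IsCircle (A ∪ B) := by
  obtain ⟨f, hf, hi, rfl, rfl, rfl⟩ := hA
  obtain ⟨g, hg, hj, hg0, hg1, rfl⟩ := hB.symm
  set k : ℝ → X := fun x => if x ≤ 1 then f x else g (x - 1) with hk
  have k1 : ∀ x ≤ 1, k x = f x := fun x hx => if_pos hx
  have k2 : ∀ x, 1 ≤ x → k x = g (x - 1) := by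
    intro x hx
    rcases hx.eq_or_lt with rfl | hx
    · simp [hk, hg0]
    · exact if_neg hx.not_ge
  have hU : Icc (0 : ℝ) 2 = Icc 0 1 ∪ Icc 1 2 :=
    (Icc_union_Icc_eq_Icc (by norm_num) (by norm_num)).symm
  have c1 : ContinuousOn k (Icc 0 1) := hf.congr fun x hx => k1 x hx.2
  have c2 : ContinuousOn k (Icc 1 2) :=
    ContinuousOn.congr (f := fun x => g (x - 1))
      (hg.comp (by fun_prop) fun x hx => ⟨by linarith [hx.1], by linarith [hx.2]⟩)
      fun x hx => k2 x hx.1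
  have hkc : ContinuousOn k (Icc 0 2) := hU ▸ c1.union_of_isClosed c2 isClosed_Icc isClosed_Icc
  have key : ∀ x ∈ Icc (0 : ℝ) 1, ∀ y ∈ Ioo (1 : ℝ) 2, k x ≠ k y := by
    intro x hx y hy hxy
    rw [k1 x hx.2, k2 y hy.1.le] at hxy
    have hy' : y - 1 ∈ Icc (0 : ℝ) 1 := ⟨by linarith [hy.1], by linarith [hy.2]⟩
    have hm : f x ∈ ({f 0, f 1} : Set X) :=
      h ▸ ⟨mem_image_of_mem _ hx, hxy ▸ mem_image_of_mem _ hy'⟩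
    rcases hm with hm | hm
    · have := hj hy' (by simp) (hxy.symm.trans (hm.trans hg1.symm))
      linarith [hy.2]
    · have := hj hy' (by simp) (hxy.symm.trans (hm.trans hg0.symm))
      linarith [hy.1]
  have hik : InjOn k (Ico 0 2) := by
    intro x hx y hy hxy
    rcases le_or_gt x 1 with hx1 | hx1 <;> rcases le_or_gt y 1 with hy1 | hy1
    · rw [k1 x hx1, k1 y hy1] at hxy
      exact hi ⟨hx.1, hx1⟩ ⟨hy.1, hy1⟩ hxy
    · exact (key x ⟨hx.1, hx1⟩ y ⟨hy1, hy.2⟩ hxy).elim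
    · exact (key y ⟨hy.1, hy1⟩ x ⟨hx1, hx.2⟩ hxy.symm).elim
    · rw [k2 x hx1.le, k2 y hy1.le] at hxy
      have := hj ⟨by linarith, by linarith [hx.2]⟩ ⟨by linarith, by linarith [hy.2]⟩ hxy
      linarith
  have h02 : k 0 = k 2 := by
    rw [k1 0 zero_le_one, k2 2 one_le_two, ← hg1]; norm_num
  have himg : k '' Icc 0 2 = f '' Icc 0 1 ∪ g '' Icc 0 1 := by
    have him : (fun x : ℝ => x - 1) '' Icc 1 2 = Icc 0 1 := by
      rw [image_sub_const_Icc]; norm_num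
    have him' : g '' Icc 0 1 = (fun x => g (x - 1)) '' Icc 1 2 := by rw [← him, image_image]
    rw [hU, image_union, image_congr fun x hx => k1 x hx.2,
      image_congr (s := Icc (1 : ℝ) 2) fun x hx => k2 x hx.1, him']
  have : Fact ((0 : ℝ) < 2) := ⟨two_pos⟩
  have hcov : ((↑) : ℝ → AddCircle (2 : ℝ)) '' Ico 0 2 = univ := by
    simpa using AddCircle.coe_image_Ico_eq (2 : ℝ) 0
  have hlift : ∀ t ∈ Ico (0 : ℝ) 2, AddCircle.liftIco 2 0 k (t : AddCircle (2 : ℝ)) = k t :=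
    fun t ht => AddCircle.liftIco_coe_apply (by simpa using ht)
  have hcont : Continuous (AddCircle.liftIco 2 0 k) := AddCircle.liftIco_zero_continuous h02 hkc
  have hinj : Function.Injective (AddCircle.liftIco 2 0 k) := by
    intro x y hxy
    obtain ⟨s, hs, rfl⟩ := hcov.symm ▸ mem_univ x
    obtain ⟨t, ht, rfl⟩ := hcov.symm ▸ mem_univ y
    rw [hlift s hs, hlift t ht] at hxy
    rw [hik hs ht hxy]
  have hrange : range (AddCircle.liftIco 2 0 k) = f '' Icc 0 1 ∪ g '' Icc 0 1 := by
    rw [← image_univ, ← hcov, image_image, image_congr hlift, ← himg,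
      ← Ico_insert_right two_pos.le, image_insert_eq, ← h02]
    exact (insert_eq_of_mem (mem_image_of_mem _ (by simp))).symm
  have e := (hcont.isClosedEmbedding hinj).isEmbedding.toHomeomorph
  rw [hrange] at e
  exact ⟨e.symm.trans (AddCircle.homeomorphCircle two_ne_zero)⟩

lemma IsCircle.isPreconnected (h : IsCircle C) : IsPreconnected C := by
  obtain ⟨e⟩ := h
  have : PreconnectedSpace C := e.symm.surjective.denseRange.preconnectedSpace e.symm.continuous
  exact isPreconnected_iff_preconnectedSpace.2 this

lemma IsCircle.nontrivial (h : IsCircle C) : C.Nontrivial := by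
  obtain ⟨e⟩ := h
  have : Nontrivial Circle := ⟨1, Circle.exp Real.pi, fun h => by
    have := congrArg ((↑) : Circle → ℂ) h
    norm_num [Circle.coe_exp] at this⟩
  exact nontrivial_coe_sort.1 e.symm.injective.nontrivial

lemma IsCircle.isPreconnected_diff_singleton (h : IsCircle C) (p : X) :
    IsPreconnected (C \ {p}) := by
  by_cases hp : p ∈ C
  · obtain ⟨f, hf, hi, h0, h1, rfl⟩ := h.exists_param hp
    convert isPreconnected_Ioo.image f hf.continuousOn (s := Ioo 0 1) using 1
    ext x
    constructor
    · rintro ⟨⟨t, ht, rfl⟩, hx⟩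
      exact ⟨t, ⟨ht.1.lt_of_ne (by rintro rfl; exact hx h0), ht.2⟩, rfl⟩
    · rintro ⟨t, ht, rfl⟩
      refine ⟨⟨t, ⟨ht.1.le, ht.2⟩, rfl⟩, fun h => ?_⟩
      exact ht.1.ne (hi (by simp) ⟨ht.1.le, ht.2⟩ (h0.trans h.symm))
  · rw [sdiff_singleton_eq_self hp]
    exact h.isPreconnected

/-- A circle is not contained in an arc. -/
lemma IsCircle.not_subset_range (h : IsCircle C) {α : unitInterval → X} (hα : IsArc α) :
    ¬ C ⊆ range α := by
  intro hC
  have hS : α '' (α ⁻¹' C) = C := image_preimage_eq_of_subset hC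
  have hnt : (α ⁻¹' C).Nontrivial := nontrivial_of_image _ _ (hS.symm ▸ h.nontrivial)
  obtain ⟨r, hr, t, ht, hrt⟩ := hnt.exists_lt
  -- Removing an intermediate point disconnects a subset of an interval, but does not disconnect a
  -- circle.
  obtain ⟨s, hrs, hst⟩ := exists_between hrt
  have h2 : IsPreconnected (α ⁻¹' C \ {s}) := by
    rw [← hα.isInducing.isPreconnected_image, image_sdiff hα.injective, hS, image_singleton]
    exact h.isPreconnected_diff_singleton _
  exact (h2.ordConnected.out ⟨hr, hrs.ne⟩ ⟨ht, hst.ne'⟩ ⟨hrs.le, hst.le⟩).2 rfl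

end

/-! ### Arcwise connectedness, and ears of a circle -/

section
open Set

variable {X : Type*} [TopologicalSpace X] {A B C : Set X} {a b c x y z p : X}

/-- Two points of `U` are equal or joined by an arc in `U`. -/
def ArcJoined (U : Set X) (x y : X) : Prop :=
  x = y ∨ ∃ A ⊆ U, IsArcBetween A x y

lemma ArcJoined.symm {U : Set X} (h : ArcJoined U x y) : ArcJoined U y x := by
  rcases h with rfl | ⟨A, hA, h⟩
  · exact Or.inl rfl
  · exact Or.inr ⟨A, hA, h.symm⟩

/-- Follow the first arc only until it first hits the second, then switch. -/
lemma ArcJoined.trans [T2Space X] {U : Set X} (h₁ : ArcJoined U x y) (h₂ : ArcJoined U y z) :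
    ArcJoined U x z := by
  rcases h₁ with rfl | ⟨A, hAU, hA⟩
  · exact h₂
  rcases h₂ with rfl | ⟨B, hBU, hB⟩
  · exact Or.inr ⟨A, hAU, hA⟩
  by_cases hxz : x = z
  · exact Or.inl hxz
  by_cases hxB : x ∈ B
  · obtain ⟨B', hB', h⟩ := hB.exists_subarc_right hxB hxz
    exact Or.inr ⟨B', hB'.trans hBU, h⟩
  obtain ⟨A', hA', c, hc, h, hAB⟩ := hA.exists_first_hit hB.isClosed hB.left_mem hxB
  by_cases hcz : c = z
  · exact Or.inr ⟨A', hA'.trans hAU, hcz ▸ h⟩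
  obtain ⟨B', hB', h'⟩ := hB.exists_subarc_right hc hcz
  exact Or.inr ⟨A' ∪ B', union_subset (hA'.trans hAU) (hB'.trans hBU),
    h.union h' (hAB ▸ inter_subset_inter_right _ hB')⟩

variable {ι : Type*} [Finite ι] {e : ι → unitInterval → X}

/-- Each edge through `p` contributes a small subinterval around `p` inside `U`; the other edges are
closed and stay away from `p`. Finiteness combines the neighbourhoods. -/
lemma ArcJoined.eventually [T2Space X] (he : ∀ i, IsArc (e i)) (hcov : ⋃ i, range (e i) = univ)
    {U : Set X} (hU : IsOpen U) (hp : p ∈ U) : ∀ᶠ q in 𝓝 p, ArcJoined U p q := by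
  have key : ∀ i, ∀ᶠ q in 𝓝 p, q ∈ range (e i) → ArcJoined U p q := by
    intro i
    by_cases hpi : p ∈ range (e i)
    · obtain ⟨t, rfl⟩ := hpi
      have hmem : e i ⁻¹' U ∈ 𝓝 t := (hU.preimage (he i).continuous).mem_nhds hp
      obtain ⟨r, r', -, hJ, hJU⟩ := exists_Icc_mem_subset_of_mem_nhds hmem
      have hJc : (Icc r r').OrdConnected := ordConnected_Icc
      have : ∀ᶠ q in 𝓝 (e i t), q ∈ range (e i) → q ∈ e i '' Icc r r' := by
        rw [(he i).isInducing.nhds_eq_comap, Filter.mem_comap] at hJ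
        obtain ⟨W, hW, hWJ⟩ := hJ
        filter_upwards [hW]
        rintro _ hq ⟨s, rfl⟩
        exact mem_image_of_mem _ (hWJ hq)
      filter_upwards [this] with q hq hqi
      obtain ⟨s, hs, rfl⟩ := hq hqi
      have htJ := mem_of_mem_nhds hJ
      rcases lt_trichotomy s t with h | rfl | h
      · exact Or.inr ⟨_, image_subset_iff.2 ((hJc.out hs htJ).trans hJU),
          ((he i).isArcBetween_image h).symm⟩
      · exact Or.inl rfl
      · exact Or.inr ⟨_, image_subset_iff.2 ((hJc.out htJ hs).trans hJU),
          (he i).isArcBetween_image h⟩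
    · filter_upwards [(isCompact_range (he i).continuous).isClosed.isOpen_compl.mem_nhds hpi]
        with q hq hq'
      exact (hq hq').elim
  filter_upwards [Filter.eventually_all.2 key] with q hq
  obtain ⟨i, hi⟩ := mem_iUnion.1 (hcov.symm ▸ mem_univ q)
  exact hq i hi

/-- In a finite union of arcs, connected open sets are arcwise connected. -/
lemma IsPreconnected.arcJoined [T2Space X] (he : ∀ i, IsArc (e i))
    (hcov : ⋃ i, range (e i) = univ) {U : Set X} (hU : IsOpen U) (hc : IsPreconnected U)
    (hx : x ∈ U) (hy : y ∈ U) : ArcJoined U x y :=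
  hc.induction₂ (ArcJoined U)
    (fun _ hp => nhdsWithin_le_nhds (ArcJoined.eventually he hcov hU hp))
    (fun _ _ _ _ _ _ => ArcJoined.trans) (fun _ _ _ _ => ArcJoined.symm) hx hy

/-- A nondegenerate arc `D` that meets `K` exactly in its end points. -/
def IsEar (K D : Set X) (a b : X) : Prop :=
  IsArcBetween D a b ∧ D ∩ K = {a, b}

lemma IsEar.symm {K D : Set X} (h : IsEar K D a b) : IsEar K D b a :=
  ⟨h.1.symm, pair_comm a b ▸ h.2⟩

/-- The union of a circle and its ears. -/
def earHull (C : Set X) : Set X := C ∪ {y | ∃ B a b, IsEar C B a b ∧ y ∈ B}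

lemma IsEar.subset_earHull (h : IsEar C B a b) : B ⊆ earHull C :=
  fun _ hy => Or.inr ⟨B, a, b, h, hy⟩

/-- The ends of the ear cut `C` into two arcs; the one containing `x` closes up with `B`. -/
lemma IsCircle.exists_circle_ear [T2Space X] (hC : IsCircle C) (h : IsEar C B a b) (hx : x ∈ C) :
    ∃ D, IsCircle D ∧ x ∈ D ∧ B ⊆ D ∧ D ⊆ C ∪ B := by
  have ha : a ∈ B ∩ C := h.2.symm ▸ mem_insert _ _
  have hb : b ∈ B ∩ C := h.2.symm ▸ Or.inr rfl
  obtain ⟨P, Q, hP, hQ, hPQ, rfl⟩ := hC.exists_arcs ha.2 hb.2 h.1.ne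
  have aux : ∀ R, IsArcBetween R a b → R ⊆ P ∪ Q → x ∈ R → ∃ D, IsCircle D ∧ x ∈ D ∧ B ⊆ D ∧
      D ⊆ P ∪ Q ∪ B := by
    intro R hR hRPQ hxR
    refine ⟨R ∪ B, hR.isCircle_union h.1 ?_, Or.inl hxR, subset_union_right,
      union_subset_union_left _ hRPQ⟩
    apply Subset.antisymm
    · rw [← h.2]
      exact fun q hq => ⟨hq.2, hRPQ hq.1⟩
    · rintro q (rfl | rfl)
      · exact ⟨hR.left_mem, ha.1⟩
      · exact ⟨hR.right_mem, hb.1⟩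
  rcases hx with hx | hx
  · exact aux P hP subset_union_left hx
  · exact aux Q hQ subset_union_right hx

/-- Prolonging `D` from `p` along `B` back to `u` gives an ear of `C` from `u` to `z`. This needs `z
≠ u`, since otherwise it would close up. -/
lemma IsEar.subset_earHull_of_mem_left {D : Set X} {u v : X} (hB : IsEar C B u v)
    (hD : IsEar (C ∪ B) D p z) (hp : p ∈ B) (hpC : p ∉ C) (hz : z ∈ C) (hzu : z ≠ u) :
    D ⊆ earHull C := by
  obtain ⟨hB, hBC⟩ := hB
  obtain ⟨hD, hDK⟩ := hD
  have hu : u ∈ B ∩ C := hBC.symm ▸ mem_insert _ _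
  have hv : v ∈ B ∩ C := hBC.symm ▸ Or.inr rfl
  have hDK' : ∀ q ∈ D, q ∈ C ∪ B → q = p ∨ q = z := fun q h1 h2 => hDK.subset ⟨h1, h2⟩
  have hBC' : ∀ q ∈ B, q ∈ C → q = u ∨ q = v := fun q h1 h2 => hBC.subset ⟨h1, h2⟩
  obtain ⟨B₁, B₂, h1, h2, rfl, h3⟩ := hB.split hp (by grind) (by grind)
  have h3' : ∀ q ∈ B₁, q ∈ B₂ → q = p := fun q h1 h2 => h3.subset ⟨h1, h2⟩
  have hv2 := h2.right_mem
  have hu1 := h1.left_mem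
  have hzD := hD.right_mem
  have hunion : IsArcBetween (B₁ ∪ D) u z := h1.union hD (by grind)
  exact subset_union_right.trans (IsEar.subset_earHull ⟨hunion, by grind⟩)

lemma IsEar.subset_earHull_of_mem_left' {D : Set X} {u v : X} (hB : IsEar C B u v)
    (hD : IsEar (C ∪ B) D p z) (hp : p ∈ B) (hpC : p ∉ C) (hz : z ∈ C) :
    D ⊆ earHull C := by
  by_cases hzu : z = u
  · exact hB.symm.subset_earHull_of_mem_left hD hp hpC hz (hzu ▸ hB.1.ne)
  · exact hB.subset_earHull_of_mem_left hD hp hpC hz hzu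

/-- Both ends of `D` lie on `B` off `C`, in the order `u`, `p`, `z`, `v`; replacing the piece of `B`
from `p` to `z` by `D` gives another ear of `C`. -/
lemma IsEar.subset_earHull_of_split {B₁ B₂ D : Set X} {u v : X} (h1 : IsArcBetween B₁ u p)
    (h2 : IsArcBetween B₂ p v) (h3 : B₁ ∩ B₂ = {p}) (hBC : (B₁ ∪ B₂) ∩ C = {u, v})
    (hD : IsEar (C ∪ (B₁ ∪ B₂)) D p z) (hpC : p ∉ C) (hzC : z ∉ C) (hz : z ∈ B₂) :
    D ⊆ earHull C := by
  obtain ⟨hD, hDK⟩ := hD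
  have hu : u ∈ (B₁ ∪ B₂) ∩ C := hBC.symm ▸ mem_insert _ _
  have hv : v ∈ (B₁ ∪ B₂) ∩ C := hBC.symm ▸ Or.inr rfl
  have hDK' : ∀ q ∈ D, q ∈ C ∪ (B₁ ∪ B₂) → q = p ∨ q = z := fun q h1 h2 => hDK.subset ⟨h1, h2⟩
  have hBC' : ∀ q ∈ B₁ ∪ B₂, q ∈ C → q = u ∨ q = v := fun q h1 h2 => hBC.subset ⟨h1, h2⟩
  have h3' : ∀ q ∈ B₁, q ∈ B₂ → q = p := fun q h1 h2 => h3.subset ⟨h1, h2⟩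
  have hpz := hD.ne
  obtain ⟨B₃, B₄, h4, h5, rfl, h6⟩ := h2.split hz hpz.symm (by grind)
  have h6' : ∀ q ∈ B₃, q ∈ B₄ → q = z := fun q h1 h2 => h6.subset ⟨h1, h2⟩
  have hu1 := h1.left_mem
  have hp3 := h4.left_mem
  have hv4 := h5.right_mem
  have hunion : IsArcBetween (B₁ ∪ D) u z := h1.union hD (by grind)
  have hunion' : IsArcBetween (B₁ ∪ D ∪ B₄) u v := hunion.union h5 (by grind)
  exact (subset_union_right.trans subset_union_left).trans
    (IsEar.subset_earHull ⟨hunion', by grind⟩)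

/-- An ear of the union of a circle and one of its ears is covered by ears of the circle. -/
lemma IsEar.subset_earHull_of_isEar {D : Set X} {u v : X} (hB : IsEar C B u v)
    (hD : IsEar (C ∪ B) D p z) : D ⊆ earHull C := by
  have hp : p ∈ D ∩ (C ∪ B) := hD.2.symm ▸ mem_insert _ _
  have hz : z ∈ D ∩ (C ∪ B) := hD.2.symm ▸ Or.inr rfl
  by_cases hpC : p ∈ C
  · by_cases hzC : z ∈ C
    · have hDK' : ∀ q ∈ D, q ∈ C ∪ B → q = p ∨ q = z := fun q h1 h2 => hD.2.subset ⟨h1, h2⟩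
      exact IsEar.subset_earHull (a := p) (b := z) ⟨hD.1, by grind⟩
    · exact hB.subset_earHull_of_mem_left' hD.symm (hz.2.resolve_left hzC) hzC hpC
  · have hpB := hp.2.resolve_left hpC
    by_cases hzC : z ∈ C
    · exact hB.subset_earHull_of_mem_left' hD hpB hpC hzC
    · have hu : u ∈ B ∩ C := hB.2.symm ▸ mem_insert _ _
      have hv : v ∈ B ∩ C := hB.2.symm ▸ Or.inr rfl
      obtain ⟨hB, hBC⟩ := hB
      obtain ⟨B₁, B₂, h1, h2, rfl, h3⟩ := hB.split hpB (by grind) (by grind)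
      rcases hz.2.resolve_left hzC with h | h
      · refine IsEar.subset_earHull_of_split h2.symm h1.symm (inter_comm B₁ B₂ ▸ h3)
          ?_ ?_ hpC hzC h
        · rw [union_comm, hBC, pair_comm]
        · rwa [union_comm B₂]
      · exact IsEar.subset_earHull_of_split h1 h2 h3 hBC hD hpC hzC h

end

/-! ### Edges, circles, and the ear hull in the absence of cut points -/

section
open Set

variable {X : Type*} [TopologicalSpace X] {A B C : Set X} {a b c x y z p q : X}

lemma IsCircle.isClosed [T2Space X] (h : IsCircle C) : IsClosed C := by
  obtain ⟨e⟩ := h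
  have : CompactSpace C := e.symm.compactSpace
  exact (isCompact_iff_compactSpace.2 this).isClosed

lemma IsArcBetween.exists_ne_ne [T2Space X] (h : IsArcBetween A a b) (p q : X) :
    ∃ x ∈ A, x ≠ p ∧ x ≠ q := by
  have hinf : A.Infinite :=
    h.isPreconnected.infinite_of_nontrivial ⟨a, h.left_mem, b, h.right_mem, h.ne⟩
  obtain ⟨x, hx, hx'⟩ := (hinf.sdiff (toFinite {p, q})).nonempty
  exact ⟨x, hx, fun h => hx' (Or.inl h), fun h => hx' (Or.inr h)⟩

variable {ι : Type*} {e : ι → unitInterval → X}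

/-- A family of arcs covering the space, any two of which meet only in common end points. -/
structure IsEdgeCover (e : ι → unitInterval → X) : Prop where
  isArc : ∀ i, IsArc (e i)
  iUnion_range : ⋃ i, range (e i) = univ
  inter_subset : ∀ i j, i ≠ j → range (e i) ∩ range (e j) ⊆ {e i 0, e i 1} ∩ {e j 0, e j 1}

namespace IsEdgeCover

variable [T2Space X] [Finite ι]

/-- The complement is the rest of this edge together with all other edges, a finite union of compact
sets. -/
lemma isOpen_image (he : IsEdgeCover e) (i : ι) {J : Set unitInterval} (hJ : IsOpen J)
    (hJ' : J ⊆ Ioo 0 1) : IsOpen (e i '' J) := by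
  have hcl : IsClosed (e i '' Jᶜ ∪ ⋃ j ∈ {j | j ≠ i}, range (e j)) :=
    (hJ.isClosed_compl.isCompact.image (he.isArc i).continuous).isClosed.union
      ((toFinite _).isClosed_biUnion fun j _ => (isCompact_range (he.isArc j).continuous).isClosed)
  convert hcl.isOpen_compl using 1
  ext x
  constructor
  · rintro ⟨t, ht, rfl⟩ (⟨s, hs, hst⟩ | h)
    · exact hs ((he.isArc i).injective hst ▸ ht)
    · obtain ⟨j, hj, hjx⟩ := mem_iUnion₂.1 h
      rcases (he.inter_subset i j (Ne.symm hj) ⟨mem_range_self t, hjx⟩).1 with h | h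
      · exact (hJ' ht).1.ne' ((he.isArc i).injective h)
      · exact (hJ' ht).2.ne ((he.isArc i).injective h)
  · intro hx
    obtain ⟨j, t, rfl⟩ := mem_iUnion.1 (he.iUnion_range.symm ▸ mem_univ x)
    by_cases hji : j = i
    · subst hji
      exact ⟨t, by_contra fun ht => hx (Or.inl (mem_image_of_mem _ ht)), rfl⟩
    · exact (hx (Or.inr (mem_iUnion₂.2 ⟨j, hji, mem_range_self t⟩))).elim

/-- `C \ {p}` is connected and misses both ends of the segment, so it stays in the open segment.
Then the circle would lie in an arc. -/
lemma false_of_mem_Ioo (he : IsEdgeCover e) (hC : IsCircle C) {i : ι} {r s t : unitInterval}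
    (ht : t ∈ Ioo r s) (htC : e i t ∈ C) (hp : p = e i r ∨ p = e i s)
    (h : ∀ q ∈ C, q ≠ p → q ≠ e i r ∧ q ≠ e i s) : False := by
  have hinj := (he.isArc i).injective
  have htp : e i t ≠ p := by
    rcases hp with rfl | rfl
    · exact fun h => ht.1.ne' (hinj h)
    · exact fun h => ht.2.ne (hinj h)
  have hU : IsOpen (e i '' Ioo r s) := he.isOpen_image i isOpen_Ioo
    (Ioo_subset_Ioo unitInterval.nonneg' unitInterval.le_one')
  have hV : IsOpen (e i '' Icc r s)ᶜ :=
    (isCompact_Icc.image (he.isArc i).continuous).isClosed.isOpen_compl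
  have hsub : C \ {p} ⊆ e i '' Ioo r s := by
    refine (hC.isPreconnected_diff_singleton p).subset_left_of_subset_union hU hV ?_ ?_
      ⟨_, ⟨htC, htp⟩, mem_image_of_mem _ ht⟩
    · exact disjoint_compl_right.mono_left (image_mono Ioo_subset_Icc_self)
    · rintro q ⟨hq, hqp⟩
      by_cases hqI : q ∈ e i '' Icc r s
      · obtain ⟨u, hu, rfl⟩ := hqI
        obtain ⟨h1, h2⟩ := h _ hq hqp
        exact Or.inl (mem_image_of_mem _ ⟨hu.1.lt_of_ne (by rintro rfl; exact h1 rfl),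
          hu.2.lt_of_ne (by rintro rfl; exact h2 rfl)⟩)
      · exact Or.inr hqI
  refine hC.not_subset_range (he.isArc i) fun q hq => ?_
  by_cases hqp : q = p
  · subst hqp
    rcases hp with rfl | rfl <;> exact mem_range_self _
  · exact image_subset_range _ _ (hsub ⟨hq, hqp⟩)

/-- A circle that meets the interior of an edge contains that edge. -/
lemma range_subset_of_isCircle (he : IsEdgeCover e) (hC : IsCircle C) {i : ι} {t : unitInterval}
    (ht : t ∈ Ioo 0 1) (htC : e i t ∈ C) : range (e i) ⊆ C := by
  rintro _ ⟨s, rfl⟩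
  by_contra hs
  rcases lt_trichotomy t s with h | rfl | h
  · exact he.false_of_mem_Ioo hC ⟨ht.1, h⟩ htC (Or.inl rfl)
      fun q hq hq' => ⟨hq', by rintro rfl; exact hs hq⟩
  · exact hs htC
  -- The end `e i s` is off `C`, so the only possible exit from the segment is the end point `e i
  -- 0`, taken as `p`.
  · exact he.false_of_mem_Ioo hC ⟨h, ht.2⟩ htC (Or.inr rfl)
      fun q hq hq' => ⟨by rintro rfl; exact hs hq, hq'⟩

lemma exists_isArcBetween (he : IsEdgeCover e) (hnc : ∀ p : X, IsPreconnected ({p}ᶜ : Set X))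
    (hx : x ≠ p) (hy : y ≠ p) (hxy : x ≠ y) : ∃ P, p ∉ P ∧ IsArcBetween P x y := by
  obtain ⟨P, hP, h⟩ := ((hnc p).arcJoined he.isArc he.iUnion_range isOpen_compl_singleton hx hy
    ).resolve_left hxy
  exact ⟨P, fun h => hP h rfl, h⟩

/-- The hull is not known to be closed, so first-hit arguments use `K`, which is `C` or `C` with a
single ear through `p`. Ears of `K` starting at `p` still lie in the hull. -/
lemma exists_closed_of_mem_earHull (hC : IsCircle C) (hp : p ∈ earHull C) :
    ∃ K, IsClosed K ∧ C ⊆ K ∧ K ⊆ earHull C ∧ p ∈ K ∧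
      ∀ D z, IsEar K D p z → D ⊆ earHull C := by
  rcases hp with hp | ⟨B, u, v, hB, hp⟩
  · exact ⟨C, hC.isClosed, subset_rfl, subset_union_left, hp, fun D z h => h.subset_earHull⟩
  · exact ⟨C ∪ B, hC.isClosed.union hB.1.isClosed, subset_union_left,
      union_subset subset_union_left hB.subset_earHull, Or.inr hp,
      fun D z h => hB.subset_earHull_of_isEar h⟩

lemma exists_mem_earHull (he : IsEdgeCover e) (hnc : ∀ p : X, IsPreconnected ({p}ᶜ : Set X))
    (hC : IsCircle C) (hA : IsArcBetween A p q) (hp : p ∈ earHull C) :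
    ∃ x ∈ A, x ∈ earHull C ∧ x ≠ p ∧ x ≠ q := by
  by_contra! hcon
  have hcon' : ∀ x ∈ A, x ∈ earHull C → x = p ∨ x = q := fun x h1 h2 => by
    have := hcon x h1 h2; tauto
  obtain ⟨K, hK, hCK, hKE, hpK, hear⟩ := exists_closed_of_mem_earHull hC hp
  have hpA := hA.left_mem
  have hqA := hA.right_mem
  by_cases hqK : q ∈ K
  · obtain ⟨x, hx, hxp, hxq⟩ := hA.exists_ne_ne p q
    refine hxq (hcon x hx (hear A q ⟨hA, ?_⟩ hx) hxp)
    grind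
  obtain ⟨y, hyC, hyp⟩ := hC.nontrivial.exists_ne p
  have hyK := hCK hyC
  obtain ⟨P, hpP, hP⟩ := he.exists_isArcBetween hnc hyp hA.ne.symm (by rintro rfl; exact hqK hyK)
  -- Cut `P` at its first point `c` on `A`, then go back from `c` to the first point `z` of `K`.
  -- Adding the part of `A` from `c` to `p` makes an ear of `K`.
  obtain ⟨P₁, hP₁, c, hcA, h1, h2⟩ := hP.exists_first_hit hA.isClosed hqA (by grind)
  have hcP := hP₁ h1.right_mem
  have hcp : c ≠ p := by rintro rfl; exact hpP hcP
  have hcK : c ∉ K := by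
    intro h
    rcases hcon' c hcA (hKE h) with rfl | rfl
    · exact hcp rfl
    · exact hqK h
  obtain ⟨P₂, hP₂, z, hzK, h3, h4⟩ := h1.symm.exists_first_hit hK hyK hcK
  obtain ⟨A', hA', h5⟩ := hA.symm.exists_subarc_right hcA hcp
  have h2' : ∀ x ∈ P₁, x ∈ A → x = c := fun x ha hb => h2.subset ⟨ha, hb⟩
  have h4' : ∀ x ∈ P₂, x ∈ K → x = z := fun x ha hb => h4.subset ⟨ha, hb⟩
  have hpA' := h5.right_mem
  have hzP := h3.right_mem
  have hD : IsEar K (A' ∪ P₂) p z := ⟨h5.symm.union h3 (by grind), by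
    ext x
    have := @hKE x
    have := hcon' x
    have := h4' x
    have := @hA' x
    simp only [mem_inter_iff, mem_union, mem_insert_iff, mem_singleton_iff]
    grind⟩
  obtain ⟨x, hx, hxp, hxq⟩ := h5.exists_ne_ne p q
  exact hxq (hcon x (hA' hx) (hear _ _ hD (Or.inl hx)) hxp)

lemma earHull_eq_univ [PreconnectedSpace X] (he : IsEdgeCover e)
    (hnc : ∀ p : X, IsPreconnected ({p}ᶜ : Set X)) (hC : IsCircle C) : earHull C = univ := by
  have hedge : ∀ i, ∀ t ∈ Ioo (0 : unitInterval) 1, e i t ∈ earHull C →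
      range (e i) ⊆ earHull C := by
    rintro i t ht (h | ⟨B, u, v, hB, h⟩)
    · exact (he.range_subset_of_isCircle hC ht h).trans subset_union_left
    · obtain ⟨D, hD, -, hBD, hDC⟩ :=
        hC.exists_circle_ear hB ((hB.2.symm ▸ mem_insert _ _ : u ∈ B ∩ C).2)
      exact (he.range_subset_of_isCircle hD ht (hBD h)).trans
        (hDC.trans (union_subset subset_union_left hB.subset_earHull))
  have hall : ∀ i, range (e i) ⊆ earHull C := by
    by_contra! hcon
    obtain ⟨i₀, hi₀⟩ := hcon
    have hcl : ∀ S : Set ι, IsClosed (⋃ i ∈ S, range (e i)) := fun S =>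
      (toFinite S).isClosed_biUnion fun j _ => (isCompact_range (he.isArc j).continuous).isClosed
    -- Two closed sets, `C` with the edges inside the hull and the remaining edges, cover the
    -- connected space and so must meet.
    obtain ⟨p, -, hp1, hp2⟩ := isPreconnected_closed_iff.1 (isPreconnected_univ (α := X)) _ _
      (hC.isClosed.union (hcl {i | range (e i) ⊆ earHull C}))
      (hcl {i | ¬ range (e i) ⊆ earHull C})
      (by
        intro x _
        obtain ⟨i, hi⟩ := mem_iUnion.1 (he.iUnion_range.symm ▸ mem_univ x)
        by_cases h : range (e i) ⊆ earHull C
        · exact Or.inl (Or.inr (mem_iUnion₂.2 ⟨i, h, hi⟩))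
        · exact Or.inr (mem_iUnion₂.2 ⟨i, h, hi⟩))
      (by
        obtain ⟨y, hy⟩ := hC.nontrivial.nonempty
        exact ⟨y, mem_univ _, Or.inl hy⟩)
      ⟨e i₀ 0, mem_univ _, mem_iUnion₂.2 ⟨i₀, hi₀, mem_range_self _⟩⟩
    obtain ⟨j, hj, s, rfl⟩ := mem_iUnion₂.1 hp2
    have hpE : e j s ∈ earHull C := by
      rcases hp1 with h | h
      · exact Or.inl h
      · obtain ⟨i, hi, h⟩ := mem_iUnion₂.1 h
        exact hi h
    have hfin : ∃ x ∈ range (e j), x ∈ earHull C ∧ x ≠ e j 0 ∧ x ≠ e j 1 := by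
      have hs : s = 0 ∨ s = 1 := by
        by_contra! h
        exact hj (hedge j s ⟨unitInterval.pos_iff_ne_zero.2 h.1,
          unitInterval.lt_one_iff_ne_one.2 h.2⟩ hpE)
      rcases hs with rfl | rfl
      · exact he.exists_mem_earHull hnc hC (he.isArc j).isArcBetween_range hpE
      · obtain ⟨x, h1, h2, h3, h4⟩ :=
          he.exists_mem_earHull hnc hC (he.isArc j).isArcBetween_range.symm hpE
        exact ⟨x, h1, h2, h4, h3⟩
    obtain ⟨_, ⟨t, rfl⟩, hE, h0, h1⟩ := hfin
    exact hj (hedge j t ⟨unitInterval.pos_iff_ne_zero.2 (by rintro rfl; exact h0 rfl),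
      unitInterval.lt_one_iff_ne_one.2 (by rintro rfl; exact h1 rfl)⟩ hE)
  rw [← univ_subset_iff, ← he.iUnion_range]
  exact iUnion_subset hall

/-- Remove an interior point `m` of an edge: an arc avoiding `m` still joins the two halves, and
trimmed to touch each half once it closes up through `m`. -/
lemma exists_isCircle [Nonempty X] (he : IsEdgeCover e)
    (hnc : ∀ p : X, IsPreconnected ({p}ᶜ : Set X)) : ∃ C : Set X, IsCircle C := by
  obtain ⟨x⟩ := ‹Nonempty X›
  obtain ⟨i, -⟩ := mem_iUnion.1 (he.iUnion_range.symm ▸ mem_univ x)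
  have hA := (he.isArc i).isArcBetween_range
  obtain ⟨m, hm, hm0, hm1⟩ := hA.exists_ne_ne (e i 0) (e i 1)
  obtain ⟨L, R, hL, hR, -, hLR⟩ := hA.split hm hm0 hm1
  have hLR' : ∀ x ∈ L, x ∈ R → x = m := fun x h1 h2 => hLR.subset ⟨h1, h2⟩
  obtain ⟨P, hmP, hP⟩ := he.exists_isArcBetween hnc hm0.symm hm1.symm hA.ne
  have hl := hL.left_mem
  have hr := hR.right_mem
  obtain ⟨P₁, hP₁, c, hcR, h1, h2⟩ := hP.exists_first_hit hR.isClosed hr (by grind)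
  have hcP := hP₁ h1.right_mem
  obtain ⟨P₂, hP₂, d, hdL, h3, h4⟩ := h1.symm.exists_first_hit hL.isClosed hl (by grind)
  have hdP := hP₁ (hP₂ h3.right_mem)
  obtain ⟨L', hL', h5⟩ := hL.exists_subarc_right hdL (by rintro rfl; exact hmP hdP)
  obtain ⟨R', hR', h6⟩ := hR.symm.exists_subarc_right hcR (by rintro rfl; exact hmP hcP)
  have h2' : ∀ x ∈ P₁, x ∈ R → x = c := fun x ha hb => h2.subset ⟨ha, hb⟩
  have h4' : ∀ x ∈ P₂, x ∈ L → x = d := fun x ha hb => h4.subset ⟨ha, hb⟩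
  have m1 := h3.left_mem
  have m2 := h3.right_mem
  have m3 := h5.left_mem
  have m4 := h6.left_mem
  have h7 : IsArcBetween (R' ∪ L') c d := h6.union h5.symm (by grind)
  exact ⟨_, h3.isCircle_union h7 (by grind)⟩

end IsEdgeCover
end

/-! ### Theta curves and arcs through three points -/

section
open Set

variable {X : Type*} [TopologicalSpace X] {A B C D : Set X} {a b x y z : X}

lemma IsArcBetween.isThetaCurve [T2Space X] (hA : IsArcBetween A a b) (hB : IsArcBetween B a b)
    (hD : IsArcBetween D a b) (hAB : A ∩ B = {a, b}) (hBD : B ∩ D = {a, b})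
    (hAD : A ∩ D = {a, b}) : IsThetaCurve (A ∪ B ∪ D) := by
  obtain ⟨α, hα, hα0, hα1, rfl⟩ := hA.exists_isArc
  obtain ⟨β, hβ, hβ0, hβ1, rfl⟩ := hB.exists_isArc
  obtain ⟨γ, hγ, hγ0, hγ1, rfl⟩ := hD.exists_isArc
  refine ⟨a, b, ![α, β, γ], ?_, ?_, ?_⟩
  · simp [Fin.forall_fin_succ, *]
  · simp [Fin.forall_fin_succ, inter_comm (range β) (range α), inter_comm (range γ), *]
  · ext x
    simp [Fin.exists_fin_succ, or_assoc]

lemma IsEdgeCover.exists_circle_or_theta [T2Space X] [ConnectedSpace X] {ι : Type*} [Finite ι]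
    {e : ι → unitInterval → X} (he : IsEdgeCover e)
    (hnc : ∀ p : X, IsPreconnected ({p}ᶜ : Set X)) (x y z : X) :
    ∃ S : Set X, (IsCircle S ∨ IsThetaCurve S) ∧ x ∈ S ∧ y ∈ S ∧ z ∈ S := by
  have step : ∀ C : Set X, IsCircle C → ∀ w ∈ C, ∀ y, ∃ D, IsCircle D ∧ w ∈ D ∧ y ∈ D := by
    intro C hC w hw y
    rcases (he.earHull_eq_univ hnc hC).symm ▸ mem_univ y with hy | ⟨B, a, b, hB, hy⟩
    · exact ⟨C, hC, hw, hy⟩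
    · obtain ⟨D, hD, hwD, hBD, -⟩ := hC.exists_circle_ear hB hw
      exact ⟨D, hD, hwD, hBD hy⟩
  obtain ⟨C₀, hC₀⟩ := he.exists_isCircle hnc
  obtain ⟨w, hw⟩ := hC₀.nontrivial.nonempty
  obtain ⟨C₁, hC₁, -, hx₁⟩ := step C₀ hC₀ w hw x
  obtain ⟨C, hC, hx, hy⟩ := step C₁ hC₁ x hx₁ y
  rcases (he.earHull_eq_univ hnc hC).symm ▸ mem_univ z with hz | ⟨B, a, b, ⟨hB, hBC⟩, hz⟩
  · exact ⟨C, Or.inl hC, hx, hy, hz⟩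
  · have ha : a ∈ B ∩ C := hBC.symm ▸ mem_insert _ _
    have hb : b ∈ B ∩ C := hBC.symm ▸ Or.inr rfl
    -- The two arcs of the circle between the ends of the ear, and the ear itself, are the three
    -- arcs of a theta curve.
    obtain ⟨P, Q, hP, hQ, hPQ, rfl⟩ := hC.exists_arcs ha.2 hb.2 hB.ne
    have := hP.left_mem
    have := hP.right_mem
    have := hQ.left_mem
    have := hQ.right_mem
    exact ⟨P ∪ Q ∪ B, Or.inr (hP.isThetaCurve hQ hB hPQ (by grind) (by grind)), Or.inl hx,
      Or.inl hy, Or.inr hz⟩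

/-- Some arc runs from `x` through `y` to `z`. -/
def ArcThrough (x y z : X) : Prop :=
  ∃ P Q, IsArcBetween P x y ∧ IsArcBetween Q y z ∧ P ∩ Q ⊆ {y}

lemma ArcThrough.exists_isArc [T2Space X] (h : ArcThrough x y z) :
    ∃ α : unitInterval → X, IsArc α ∧
      ∃ t : Fin 3 → unitInterval, StrictMono t ∧ ∀ i, α (t i) = ![x, y, z] i := by
  obtain ⟨P, Q, hP, hQ, hPQ⟩ := h
  obtain ⟨f, hf, hi, rfl, rfl, rfl, -⟩ := hP.exists_param_union hQ hPQ
  have hmaps : MapsTo (fun t : ℝ => 2 * t) (Icc 0 1) (Icc 0 2) := fun t ht =>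
    ⟨by linarith [ht.1], by linarith [ht.2]⟩
  refine ⟨_, exists_isArc_of_injOn (f := fun t => f (2 * t)) (hf.comp (by fun_prop) hmaps)
    (hi.comp (fun s _ t _ h => by simpa using h) hmaps),
    ![0, ⟨1 / 2, by norm_num, by norm_num⟩, 1], ?_, ?_⟩
  · rw [Fin.strictMono_iff_lt_succ]
    intro i
    fin_cases i <;> simp [← Subtype.coe_lt_coe]
    norm_num
  · simp [Fin.forall_fin_succ]

lemma IsCircle.arcThrough (hC : IsCircle C) (hx : x ∈ C) (hy : y ∈ C) (hz : z ∈ C) (hxy : x ≠ y)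
    (hyz : y ≠ z) (hxz : x ≠ z) : ArcThrough x y z := by
  obtain ⟨P, Q, hP, hQ, -, rfl⟩ := hC.exists_arcs hx hz hxz
  rcases hy with hy | hy
  · obtain ⟨P₁, P₂, h1, h2, -, h3⟩ := hP.split hy hxy.symm hyz
    exact ⟨P₁, P₂, h1, h2, h3.subset⟩
  · obtain ⟨P₁, P₂, h1, h2, -, h3⟩ := hQ.split hy hxy.symm hyz
    exact ⟨P₁, P₂, h1, h2, h3.subset⟩

/-- In the generic case the route is `x`, `a`, `y`, `b`, `z`: along `A` to `a`, across the whole of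
`B`, then along `D` from `b`. If one of the points is shared with another arc, all three may lie on
a circle. -/
lemma arcThrough_of_theta [T2Space X] (hA : IsArcBetween A a b) (hB : IsArcBetween B a b)
    (hD : IsArcBetween D a b) (hAB : A ∩ B = {a, b}) (hBD : B ∩ D = {a, b})
    (hAD : A ∩ D = {a, b}) (hx : x ∈ A) (hy : y ∈ B) (hz : z ∈ D) (hxy : x ≠ y)
    (hyz : y ≠ z) (hxz : x ≠ z) : ArcThrough x y z := by
  by_cases hxB : x ∈ B
  · exact (hB.isCircle_union hD hBD).arcThrough (Or.inl hxB) (Or.inl hy) (Or.inr hz) hxy hyz hxz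
  by_cases hyA : y ∈ A
  · exact (hA.isCircle_union hD hAD).arcThrough (Or.inl hx) (Or.inl hyA) (Or.inr hz) hxy hyz hxz
  by_cases hzA : z ∈ A
  · exact (hA.isCircle_union hB hAB).arcThrough (Or.inl hx) (Or.inr hy) (Or.inl hzA) hxy hyz hxz
  have haA := hA.left_mem
  have hbA := hA.right_mem
  have haB := hB.left_mem
  have hbB := hB.right_mem
  have haD := hD.left_mem
  have hbD := hD.right_mem
  have hAB' : ∀ q ∈ A, q ∈ B → q = a ∨ q = b := fun q h1 h2 => hAB.subset ⟨h1, h2⟩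
  have hBD' : ∀ q ∈ B, q ∈ D → q = a ∨ q = b := fun q h1 h2 => hBD.subset ⟨h1, h2⟩
  have hAD' : ∀ q ∈ A, q ∈ D → q = a ∨ q = b := fun q h1 h2 => hAD.subset ⟨h1, h2⟩
  obtain ⟨A₁, A₂, hA1, hA2, rfl, hA3⟩ := hA.split hx (by grind) (by grind)
  obtain ⟨B₁, B₂, hB1, hB2, rfl, hB3⟩ := hB.split hy (by grind) (by grind)
  obtain ⟨D₁, D₂, hD1, hD2, rfl, hD3⟩ := hD.split hz (by grind) (by grind)
  have hA3' : ∀ q ∈ A₁, q ∈ A₂ → q = x := fun q h1 h2 => hA3.subset ⟨h1, h2⟩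
  have hB3' : ∀ q ∈ B₁, q ∈ B₂ → q = y := fun q h1 h2 => hB3.subset ⟨h1, h2⟩
  have hD3' : ∀ q ∈ D₁, q ∈ D₂ → q = z := fun q h1 h2 => hD3.subset ⟨h1, h2⟩
  have m1 := hA1.left_mem
  have m2 := hA2.right_mem
  have m3 := hB1.left_mem
  have m4 := hB2.right_mem
  have m5 := hD1.left_mem
  have m6 := hD2.right_mem
  have k1 : ∀ q ∈ A₁, q ∈ B₁ → q = a ∨ q = b := fun q h h' => hAB' q (Or.inl h) (Or.inl h')
  have k2 : ∀ q ∈ A₁, q ∈ B₂ → q = a ∨ q = b := fun q h h' => hAB' q (Or.inl h) (Or.inr h')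
  have k3 : ∀ q ∈ A₁, q ∈ D₂ → q = a ∨ q = b := fun q h h' => hAD' q (Or.inl h) (Or.inr h')
  have k4 : ∀ q ∈ B₁, q ∈ D₂ → q = a ∨ q = b := fun q h h' => hBD' q (Or.inl h) (Or.inr h')
  have k5 : ∀ q ∈ B₂, q ∈ D₂ → q = a ∨ q = b := fun q h h' => hBD' q (Or.inr h) (Or.inr h')
  exact ⟨A₁ ∪ B₁, B₂ ∪ D₂, hA1.symm.union hB1 (by grind), hB2.union hD2.symm (by grind), by grind⟩

lemma IsThetaCurve.arcThrough [T2Space X] {T : Set X} (hT : IsThetaCurve T) (hx : x ∈ T)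
    (hy : y ∈ T) (hz : z ∈ T) (hxy : x ≠ y) (hyz : y ≠ z) (hxz : x ≠ z) : ArcThrough x y z := by
  obtain ⟨a, b, α, hα, hint, rfl⟩ := hT
  have harc : ∀ i, IsArcBetween (range (α i)) a b := fun i => by
    obtain ⟨h, rfl, rfl⟩ := hα i
    exact h.isArcBetween_range
  obtain ⟨i, hi⟩ := mem_iUnion.1 hx
  obtain ⟨j, hj⟩ := mem_iUnion.1 hy
  obtain ⟨k, hk⟩ := mem_iUnion.1 hz
  -- Either the points use all three arcs, or two of the arcs, which form a circle, contain them
  -- all.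
  have hijk : (i ≠ j ∧ j ≠ k ∧ i ≠ k) ∨
      ∃ l m, l ≠ m ∧ (i = l ∨ i = m) ∧ (j = l ∨ j = m) ∧ (k = l ∨ k = m) := by
    clear * -
    revert i j k
    decide
  rcases hijk with ⟨hij, hjk, hik⟩ | ⟨l, m, hlm, hil, hjl, hkl⟩
  · exact arcThrough_of_theta (harc i) (harc j) (harc k) (hint _ _ hij) (hint _ _ hjk)
      (hint _ _ hik) hi hj hk hxy hyz hxz
  · have aux : ∀ n w, w ∈ range (α n) → n = l ∨ n = m → w ∈ range (α l) ∪ range (α m) := by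
      rintro n w hw (rfl | rfl)
      · exact Or.inl hw
      · exact Or.inr hw
    exact ((harc l).isCircle_union (harc m) (hint _ _ hlm)).arcThrough (aux _ _ hi hil)
      (aux _ _ hj hjl) (aux _ _ hk hkl) hxy hyz hxz

lemma IsSac.isPreconnected_compl_singleton (h : IsSac 3 X) (p : X) :
    IsPreconnected ({p}ᶜ : Set X) := by
  refine isPreconnected_of_forall_pair fun x hx y hy => ?_
  by_cases hxy : x = y
  · subst hxy
    exact ⟨{x}, singleton_subset_iff.2 hx, rfl, rfl, isPreconnected_singleton⟩
  -- With `p` visited last, the stretch from `x` to `y` avoids it.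
  have hinj : Function.Injective ![x, y, p] := by
    intro i j hij
    have hx' : x ≠ p := hx
    have hy' : y ≠ p := hy
    fin_cases i <;> fin_cases j <;> simp_all [eq_comm]
  obtain ⟨α, hα, t, ht, hxt⟩ := h _ hinj
  have h01 : t 0 < t 1 := ht (by decide)
  have h12 : t 1 < t 2 := ht (by decide)
  have h0 : α (t 0) = x := hxt 0
  have h1 : α (t 1) = y := hxt 1
  have h2 : α (t 2) = p := hxt 2
  refine ⟨α '' Icc (t 0) (t 1), ?_, ⟨_, ⟨le_rfl, h01.le⟩, h0⟩, ⟨_, ⟨h01.le, le_rfl⟩, h1⟩,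
    isPreconnected_Icc.image _ hα.continuous.continuousOn⟩
  rintro _ ⟨s, hs, rfl⟩ (hsp : α s = p)
  exact (hs.2.trans_lt h12).ne (hα.injective (hsp.trans h2.symm))

end

theorem mainTheorem8 (X : Type*) [TopologicalSpace X] (hX : IsFiniteGraph X) :
    List.TFAE [
      ∀ p : X, ¬ IsCutPoint p,
      IsSac 3 X,
      ∀ x y z : X, ∃ S : Set X, (IsCircle S ∨ IsThetaCurve S) ∧ x ∈ S ∧ y ∈ S ∧ z ∈ S] := by
  obtain ⟨⟨-, hconn, hmet⟩, m, e, hearc, hcov, hint⟩ := hX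
  have he : IsEdgeCover e := ⟨hearc, hcov, hint⟩
  have : T2Space X := inferInstance
  tfae_have 1 → 3 := fun h =>
    he.exists_circle_or_theta fun p => (not_not.1 (h p)).isPreconnected
  tfae_have 3 → 2 := by
    intro h w hw
    obtain ⟨S, hS, h0, h1, h2⟩ := h (w 0) (w 1) (w 2)
    have h01 : w 0 ≠ w 1 := hw.ne (by decide)
    have h12 : w 1 ≠ w 2 := hw.ne (by decide)
    have h02 : w 0 ≠ w 2 := hw.ne (by decide)
    have harc : ArcThrough (w 0) (w 1) (w 2) := by
      rcases hS with hS | hS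
      · exact hS.arcThrough h0 h1 h2 h01 h12 h02
      · exact hS.arcThrough h0 h1 h2 h01 h12 h02
    obtain ⟨α, hα, t, ht, hwt⟩ := harc.exists_isArc
    refine ⟨α, hα, t, ht, ?_⟩
    simpa [Fin.forall_fin_succ] using hwt
  tfae_have 2 → 1 := by
    intro h p hp
    refine hp ⟨?_, h.isPreconnected_compl_singleton p⟩
    -- `IsConnected` also demands that the complement of `p` be nonempty; an edge supplies a second
    -- point.
    obtain ⟨i, -⟩ := Set.mem_iUnion.1 (hcov.symm ▸ Set.mem_univ p)
    obtain ⟨x, -, hx, -⟩ := (hearc i).isArcBetween_range.exists_ne_ne p p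
    exact ⟨x, hx⟩
  tfae_finish
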